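/- Let $m\in\mathbb N$, let $\mu^-,\mu^+$ be finite Borel measures on $\mathbb R^m$ of equal total mass, $\alpha\in[0,1]$ and $c>0$. For a rectifiable $1$-current $T=\underline{\underline{\tau}}(M,\theta,\xi)$, i.e. $T(\omega)=\int_M\theta\,\langle\omega,\xi\rangle\,d\mathcal H^1$ with $M$ a countably $1$-rectifiable $\mathcal H^1$-measurable set, $\theta>0$ locally $\mathcal H^1$-integrable on $M$ and $\xi$ a measurable field of unit vectors tangent to $M$, put $$\mathbf M_{\alpha,c}(T)=c^\alpha\int_M\left\lfloor\tfrac{\theta(x)}{c}\right\rfloor+\left(\tfrac{\theta(x)}{c}-\left\lfloor\tfrac{\theta(x)}{c}\right\rfloor\right)^\alpha d\mathcal H^1(x)\in[0,\infty],$$ where $0^\alpha:=0$ also for $\alpha=0$; this depends only on the current $T$. Let $T=\underline{\underline{\tau}}(M,\theta,\xi)$ be a rectifiable $1$-current with $\partial T=\mu^+-\mu^-$. Let $v_1,v_2\in M$ and let $\gamma_0:[0,1]\to M$ be a continuous curve with $\gamma_0(0)=v_1$, $\gamma_0(1)=v_2$, differentiable with $\gamma_0'(t)\neq0$ on $(0,1)$,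 that runs in the direction of $\xi$: for $\mathcal H^1$-almost every $x\in\gamma_0([0,1])$, $\gamma_0'(t)/|\gamma_0'(t)|=\xi(x)$ for all $t\in(0,1)$ with $\gamma_0(t)=x$. Let $$\theta_0=\min\left\{\left\lfloor\tfrac{\theta(\gamma_0(t))}{c}\right\rfloor : t\in[0,1]\right\}.$$ Let $\overline{v_1v_2}=\{(1-t)v_1+tv_2:t\in[0,1]\}$, let $\llbracket\overline{v_1v_2}\rrbracket=\underline{\underline{\tau}}\bigl(\overline{v_1v_2},1,\tfrac{v_2-v_1}{|v_2-v_1|}\bigr)$ (the zero current if $v_1=v_2$), and let $\llbracket\gamma_0([0,1])\rrbracket=\underline{\underline{\tau}}\bigl(\gamma_0([0,1]),1,\tfrac{\gamma_0'}{|\gamma_0'|}\bigr)$. Then $T+\theta_0c\,\llbracket\overline{v_1v_2}\rrbracket-\theta_0c\,\llbracket\gamma_0([0,1])\rrbracket$ is a rectifiable $1$-current and $$\mathbf M_{\alpha,c}\bigl(T+\theta_0c\,\llbracket\overline{v_1v_2}\rrbracket-\theta_0c\,\llbracket\gamma_0([0,1])\rrbracket\bigr)\le\mathbf M_{\alpha,c}(T).$$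 Moreover, if $\theta_0\ge1$ and $\mathbf M_{\alpha,c}(T)<\infty$, then equality holds if and only if $\overline{v_1v_2}=\gamma_0([0,1])$. -/

import Mathlib

open MeasureTheory Set TopologicalSpace
open scoped Distributions

noncomputable section

/-- The ambient space `ℝᵐ` with its Euclidean norm. -/
abbrev Euc (m : ℕ) : Type := EuclideanSpace ℝ (Fin m)

/-- Smooth compactly supported functions (`0`-forms) on `ℝᵐ`. -/
abbrev ZeroForm (m : ℕ) : Type := 𝓓((⊤ : Opens (Euc m)), ℝ)

/-- Smooth compactly supported `1`-forms on `ℝᵐ`. -/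
abbrev OneForm (m : ℕ) : Type := 𝓓((⊤ : Opens (Euc m)), Euc m →L[ℝ] ℝ)

/-- `1`-currents on `ℝᵐ`: continuous linear functionals on the test `1`-forms. -/
abbrev OneCurrent (m : ℕ) : Type := OneForm m →L[ℝ] ℝ

/-- The exterior derivative of a compactly supported function. -/
def extDerivZero {m : ℕ} (φ : ZeroForm m) : OneForm m :=
  TestFunction.fderivCLM ℝ ⊤ ⊤ φ

theorem extDerivZero_apply {m : ℕ} (φ : ZeroForm m) (x : Euc m) :
    extDerivZero φ x = fderiv ℝ φ x := by
  simp [extDerivZero, TestFunction.fderivCLM_apply]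

/-- The current `τ(M, θ, ξ)`, i.e. `ω ↦ ∫_M θ(x) ⟨ω(x), ξ(x)⟩ dℋ¹(x)`
(see `tau_apply` below). -/
def tau {m : ℕ} (M : Set (Euc m)) (θ : Euc m → ℝ) (ξ : Euc m → Euc m) : OneCurrent m :=
  TestFunction.integralAgainstBilinCLM (ContinuousLinearMap.id ℝ (Euc m →L[ℝ] ℝ))
    (μH[1].restrict M) (fun x => θ x • ξ x)

theorem tau_apply {m : ℕ} (M : Set (Euc m)) (θ : Euc m → ℝ) (ξ : Euc m → Euc m)
    (h : LocallyIntegrable (fun x => θ x • ξ x) (μH[1].restrict M)) (ω : OneForm m) :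
    tau M θ ξ ω = ∫ x in M, θ x * ω x (ξ x) ∂μH[1] := by
  simp [tau, TestFunction.integralAgainstBilinCLM_apply, h.locallyIntegrableOn]

/-- `M` is countably `1`-rectifiable: up to an `ℋ¹`-null set it is covered by countably many
Lipschitz images of the line. -/
def IsCountablyRectifiable {m : ℕ} (M : Set (Euc m)) : Prop :=
  ∃ σ : ℕ → ℝ → Euc m, (∀ j, ∃ K, LipschitzWith K (σ j)) ∧
    μH[1] (M \ ⋃ j, range (σ j)) = 0

/-- The field `ξ` is tangent to `M` at `ℋ¹`-almost every point: every Lipschitz curve has, at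
almost every time at which it is in `M`, a velocity that is a multiple of `ξ`. (For a countably
rectifiable `M` and unit vectors `ξ` this says that `ξ` spans the approximate tangent line of `M`
`ℋ¹`-almost everywhere.) -/
def IsTangentField {m : ℕ} (M : Set (Euc m)) (ξ : Euc m → Euc m) : Prop :=
  ∀ σ : ℝ → Euc m, (∃ K, LipschitzWith K σ) →
    ∀ᵐ t : ℝ, σ t ∈ M → ∃ s : ℝ, deriv σ t = s • ξ (σ t)

/-- Data `(M, θ, ξ)` of a (real) rectifiable `1`-current `τ(M, θ, ξ)`: a countably rectifiable set,
a positive locally integrable density, and a measurable orientation of the tangent lines. -/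
structure RectData (m : ℕ) where
  carrier : Set (Euc m)
  density : Euc m → ℝ
  direction : Euc m → Euc m
  nullMeasurable : NullMeasurableSet carrier μH[1]
  rectifiable : IsCountablyRectifiable carrier
  density_pos : ∀ x ∈ carrier, 0 < density x
  density_locallyIntegrable : LocallyIntegrable density (μH[1].restrict carrier)
  direction_measurable : AEStronglyMeasurable direction (μH[1].restrict carrier)
  direction_unit : ∀ᵐ x ∂(μH[1].restrict carrier), ‖direction x‖ = 1
  direction_tangent : IsTangentField carrier direction

/-- The rectifiable current with the given data. -/
def RectData.current {m : ℕ} (T : RectData m) : OneCurrent m :=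
  tau T.carrier T.density T.direction

/-- `T ∈ Path(μ⁻, μ⁺)`, i.e. `∂T = μ⁺ - μ⁻`. -/
def IsTransportPath {m : ℕ} (μm μp : Measure (Euc m)) (T : OneCurrent m) : Prop :=
  ∀ φ : ZeroForm m, T (extDerivZero φ) = ∫ x, φ x ∂μp - ∫ x, φ x ∂μm

/-- `H_{c,α}(x) = ⌊x/c⌋ + (x/c - ⌊x/c⌋)^α`, with `0 ^ α = 0` also for `α = 0`, so that
`H_{c,α}(n c) = n` for every integer `n`. -/
def capCost (α c x : ℝ) : ℝ :=
  (⌊x / c⌋ : ℝ) + if Int.fract (x / c) = 0 then 0 else Int.fract (x / c) ^ α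

/-- `M_{α,c}(τ(M, θ, ξ)) = c^α ∫_M H_{c,α}(θ) dℋ¹`, a number in `[0, ∞]`. -/
def RectData.cost {m : ℕ} (α c : ℝ) (T : RectData m) : ENNReal :=
  ENNReal.ofReal (c ^ α) *
    ∫⁻ x in T.carrier, ENNReal.ofReal (capCost α c (T.density x)) ∂μH[1]

/-- `Γ(v₁, v₂)`: the curves `γ : [0,1] → M` from `v₁` to `v₂` with `γ'(t) ≠ 0` on `(0,1)`. -/
structure IsRegularCurve {m : ℕ} (M : Set (Euc m)) (v₁ v₂ : Euc m) (γ : ℝ → Euc m) : Prop where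
  continuousOn : ContinuousOn γ (Icc 0 1)
  mapsTo : MapsTo γ (Icc 0 1) M
  source : γ 0 = v₁
  target : γ 1 = v₂
  differentiable : ∀ t ∈ Ioo (0 : ℝ) 1, DifferentiableAt ℝ γ t
  deriv_ne_zero : ∀ t ∈ Ioo (0 : ℝ) 1, deriv γ t ≠ 0

/-- The unit vector `v / |v|`. -/
def unitVec {m : ℕ} (v : Euc m) : Euc m := ‖v‖⁻¹ • v

open Classical in
/-- The unit tangent `γ'(t) / |γ'(t)|` as a field on the image: its value at `x = γ(t)`. If the
curve passes several times through `x`, one of the parameters is used; this is immaterial for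
curves that pass through almost every point of the image in one direction only. -/
def curveDirection {m : ℕ} (γ : ℝ → Euc m) (x : Euc m) : Euc m :=
  if h : ∃ t ∈ Ioo (0 : ℝ) 1, γ t = x then unitVec (deriv γ h.choose) else 0

/-- `γ` runs along `ξ`: at `ℋ¹`-almost every point `x` of the image, the unit tangent of `γ` at
each of its passages through `x` is `ξ(x)`. -/
def RunsAlong {m : ℕ} (γ : ℝ → Euc m) (ξ : Euc m → Euc m) : Prop :=
  ∀ᵐ x ∂(μH[1].restrict (γ '' Icc (0 : ℝ) 1)),
    ∀ t ∈ Ioo (0 : ℝ) 1, γ t = x → unitVec (deriv γ t) = ξ x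

/-- The multiplicity-one current of the oriented image `γ([0,1])`. -/
def curveCurrent {m : ℕ} (γ : ℝ → Euc m) : OneCurrent m :=
  tau (γ '' Icc (0 : ℝ) 1) (fun _ => 1) (curveDirection γ)

/-- The multiplicity-one current of the segment from `v₁` to `v₂` (zero if `v₁ = v₂`). -/
def segmentCurrent {m : ℕ} (v₁ v₂ : Euc m) : OneCurrent m :=
  tau (segment ℝ v₁ v₂) (fun _ => 1) (fun _ => unitVec (v₂ - v₁))

end

open scoped Topology

/-! A rectifiable current is integration against the field θξ extended by zero, and it determines
this field ℋ¹-almost everywhere. Costs can therefore be computed on one convenient representative: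
the field with θ₀c removed along the image I of the curve and added along the segment
(`RectData.reroute`). Almost everywhere its norm is at most the old norm plus θ₀c(1_segment − 1_I).
Since `capCost` is monotone and grows by exactly n when its argument grows by nc, integration gives
new + θ₀ℋ¹(I) ≤ old + θ₀|v₁ − v₂| (`lintegral_capCost_reroute_le`). As I is connected, ℋ¹(I) ≥ |v₁ −
v₂|.

Equality at finite cost forces ℋ¹(I) ≤ |v₁ − v₂|. Projection to the line through v₁ and v₂ then
loses no length of I, so any part of I that it strictly contracts is null. The times at which γ'
leaves the direction of the line split into countably many pieces with contracted images; hence the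
coordinates of γ orthogonal to the line have null range and, by connectedness, are constant.
Conversely, a regular curve whose image is the segment runs in the direction of the segment, so the
added and removed currents cancel. -/

theorem MeasureTheory.LocallyIntegrable.indicator_of_restrict {X F : Type*} [TopologicalSpace X]
    [MeasurableSpace X] [NormedAddCommGroup F] {μ : Measure X} {s : Set X} {f : X → F}
    (hs : NullMeasurableSet s μ) (hf : LocallyIntegrable f (μ.restrict s)) :
    LocallyIntegrable (s.indicator f) μ := by
  obtain ⟨t, -, ht, hts⟩ := hs.exists_measurable_superset_ae_eq
  rw [← Measure.restrict_congr_set hts] at hf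
  refine LocallyIntegrable.congr ?_ (indicator_ae_eq_of_ae_eq_set (f := f) hts)
  intro x
  obtain ⟨U, hU, hfU⟩ := hf x
  refine ⟨U, hU, ?_⟩
  rw [integrableOn_indicator_iff ht, inter_comm]
  rwa [IntegrableOn, Measure.restrict_restrict' ht] at hfU

/-! ### The vector field of a rectifiable current -/

namespace RectData

variable {m : ℕ}

/-- The density times the direction, extended by zero to the whole space. -/
noncomputable def field (T : RectData m) : Euc m → Euc m :=
  T.carrier.indicator fun x => T.density x • T.direction x

theorem locallyIntegrable_smul (T : RectData m) :
    LocallyIntegrable (fun x => T.density x • T.direction x) (μH[1].restrict T.carrier) := by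
  refine T.density_locallyIntegrable.mono
    (T.density_locallyIntegrable.aestronglyMeasurable.smul T.direction_measurable) ?_
  filter_upwards [T.direction_unit] with x hx
  simp [norm_smul, hx]

theorem field_locallyIntegrable (T : RectData m) : LocallyIntegrable T.field μH[1] :=
  T.locallyIntegrable_smul.indicator_of_restrict T.nullMeasurable

theorem current_apply (T : RectData m) (ω : OneForm m) :
    T.current ω = ∫ x, ω x (T.field x) ∂μH[1] := by
  rw [current, tau_apply _ _ _ T.locallyIntegrable_smul, ← integral_indicator₀ T.nullMeasurable]
  congr 1 with x
  by_cases hx : x ∈ T.carrier <;> simp [field, hx]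

theorem norm_field (T : RectData m) :
    ∀ᵐ x ∂μH[1], ‖T.field x‖ = T.carrier.indicator T.density x := by
  filter_upwards [(ae_restrict_iff'₀ T.nullMeasurable).1 T.direction_unit] with x hx
  by_cases h : x ∈ T.carrier
  · simp [field, h, norm_smul, hx h, abs_of_pos (T.density_pos x h)]
  · simp [field, h]

/-- Testing with the forms g⟨v, ·⟩, for g smooth with compact support and v a fixed vector, reduces
this to the fundamental lemma of the calculus of variations. -/
theorem field_ae_eq_of_current_eq {S T : RectData m} (h : S.current = T.current) :
    S.field =ᵐ[μH[1]] T.field := by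
  have hS := S.field_locallyIntegrable
  have hT := T.field_locallyIntegrable
  have key : ∀ᵐ x ∂μH[1], (S.field - T.field) x = 0 := by
    refine ae_eq_zero_of_integral_contDiff_smul_eq_zero (hS.sub hT) fun g hg hgs => ?_
    have hi : ∀ {W : Euc m → Euc m}, LocallyIntegrable W μH[1] →
        Integrable (fun x => g x • W x) μH[1] := fun hW =>
      hW.integrable_smul_left_of_hasCompactSupport hg.continuous hgs
    simp only [Pi.sub_apply, smul_sub]
    rw [integral_sub (hi hS) (hi hT), sub_eq_zero]
    refine ext_inner_left ℝ fun v => ?_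
    have hsm : ContDiff ℝ (⊤ : ℕ∞) fun x => g x • innerSL ℝ v := hg.smul contDiff_const
    let ω : OneForm m := ⟨fun x => g x • innerSL ℝ v, hsm, hgs.smul_right, subset_univ _⟩
    have hω : ∀ (x w : Euc m), ω x w = inner ℝ v (g x • w) := fun x w => by
      change g x • inner ℝ v w = _
      rw [inner_smul_right, smul_eq_mul]
    have := congrArg (fun A : OneCurrent m => A ω) h
    simp only [current_apply, hω] at this
    rwa [← integral_inner (hi hS), ← integral_inner (hi hT)]
  filter_upwards [key] with x hx
  exact sub_eq_zero.1 hx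

/-- The carrier can be dropped because `capCost` vanishes at 0; for α = 0 this uses the convention 0
^ 0 = 0. -/
theorem cost_eq (T : RectData m) (α c : ℝ) : T.cost α c =
    ENNReal.ofReal (c ^ α) * ∫⁻ x, ENNReal.ofReal (capCost α c ‖T.field x‖) ∂μH[1] := by
  rw [cost, ← lintegral_indicator₀ T.nullMeasurable]
  congr 1
  refine lintegral_congr_ae ?_
  filter_upwards [T.norm_field] with x hx
  by_cases h : x ∈ T.carrier <;> simp [hx, h, capCost]

theorem cost_eq_of_current_eq {S T : RectData m} (h : S.current = T.current) (α c : ℝ) :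
    S.cost α c = T.cost α c := by
  rw [cost_eq, cost_eq]
  congr 1
  refine lintegral_congr_ae ?_
  filter_upwards [field_ae_eq_of_current_eq h] with x hx
  rw [hx]

end RectData

/-! ### Rectifiable currents built from tangent fields -/

theorem norm_unitVec {m : ℕ} {v : Euc m} (hv : v ≠ 0) : ‖unitVec v‖ = 1 := by
  simp [unitVec, norm_smul, hv]

theorem norm_smul_unitVec {m : ℕ} (v : Euc m) : ‖v‖ • unitVec v = v := by
  by_cases hv : v = 0
  · simp [hv]
  · rw [unitVec, smul_inv_smul₀ (norm_ne_zero_iff.2 hv)]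

theorem unitVec_smul_of_pos {m : ℕ} {r : ℝ} (hr : 0 < r) (v : Euc m) :
    unitVec (r • v) = unitVec v := by
  rw [unitVec, unitVec, norm_smul, Real.norm_of_nonneg hr.le, smul_smul]
  congr 1
  field_simp

namespace RectData

variable {m : ℕ}

theorem nullMeasurableSet_support {W : Euc m → Euc m} (hW : LocallyIntegrable W μH[1]) :
    NullMeasurableSet (Function.support W) μH[1] := by
  rw [show Function.support W = W ⁻¹' {0}ᶜ by ext; simp]
  exact hW.aestronglyMeasurable.aemeasurable.nullMeasurable (measurableSet_singleton _).compl

/-- A locally integrable field supported on a rectifiable set and tangent to it, as data of a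
rectifiable current. -/
noncomputable def ofField (W : Euc m → Euc m) (hW : LocallyIntegrable W μH[1])
    (hrect : IsCountablyRectifiable (Function.support W))
    (htan : IsTangentField (Function.support W) W) : RectData m where
  carrier := Function.support W
  density x := ‖W x‖
  direction x := unitVec (W x)
  nullMeasurable := nullMeasurableSet_support hW
  rectifiable := hrect
  density_pos x hx := norm_pos_iff.2 hx
  density_locallyIntegrable := (hW.mono_measure Measure.restrict_le_self).mono
    hW.aestronglyMeasurable.norm.restrict (by simp)
  direction_measurable :=
    (hW.aestronglyMeasurable.aemeasurable.norm.inv.smul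
      hW.aestronglyMeasurable.aemeasurable).aestronglyMeasurable.restrict
  direction_unit := by
    filter_upwards [ae_restrict_mem₀ (nullMeasurableSet_support hW)] with x hx
    exact norm_unitVec hx
  direction_tangent σ hσ := by
    filter_upwards [htan σ hσ] with t ht hmem
    obtain ⟨s, hs⟩ := ht hmem
    exact ⟨s * ‖W (σ t)‖, by rw [mul_smul, norm_smul_unitVec, hs]⟩

theorem field_ofField (W : Euc m → Euc m) (hW : LocallyIntegrable W μH[1])
    (hrect : IsCountablyRectifiable (Function.support W))
    (htan : IsTangentField (Function.support W) W) : (ofField W hW hrect htan).field = W := by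
  ext1 x
  by_cases hx : W x = 0 <;> simp [field, ofField, hx, norm_smul_unitVec]

end RectData

theorem IsCountablyRectifiable.mono {m : ℕ} {A B : Set (Euc m)} (hB : IsCountablyRectifiable B)
    (h : A ⊆ B) : IsCountablyRectifiable A := by
  obtain ⟨σ, hσ, h0⟩ := hB
  exact ⟨σ, hσ, measure_mono_null (sdiff_subset_sdiff_left h) h0⟩

theorem IsCountablyRectifiable.union_segment {m : ℕ} {A : Set (Euc m)}
    (hA : IsCountablyRectifiable A) (v w : Euc m) :
    IsCountablyRectifiable (A ∪ segment ℝ v w) := by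
  obtain ⟨σ, hσ, h0⟩ := hA
  refine ⟨fun j => Nat.casesOn j (AffineMap.lineMap v w) σ, ?_, measure_mono_null ?_ h0⟩
  · rintro (_ | j)
    · exact ⟨_, lipschitzWith_lineMap v w⟩
    · exact hσ j
  · rintro x ⟨hx, hx'⟩
    rw [mem_iUnion, not_exists] at hx'
    rcases hx with hx | hx
    · refine ⟨hx, ?_⟩
      rw [mem_iUnion, not_exists]
      exact fun j => hx' (j + 1)
    · rw [segment_eq_image_lineMap] at hx
      exact absurd (image_subset_range _ _ hx) (hx' 0)

/-- At almost every parameter of a Lipschitz curve in a segment, the velocity is parallel to it. -/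
theorem isTangentField_segment {m : ℕ} (v w : Euc m) :
    IsTangentField (segment ℝ v w) fun _ => unitVec (w - v) := by
  rintro σ ⟨K, hσ⟩
  -- All but countably many times in the preimage are accumulated from the right by the preimage.
  -- There the derivative is a limit of difference quotients between points of the segment.
  have hc : {t ∈ σ ⁻¹' segment ℝ v w | 𝓝[σ ⁻¹' segment ℝ v w ∩ Ioi t] t = ⊥}.Countable :=
    countable_setOfPred_isolated_right_within
  filter_upwards [hσ.ae_differentiableAt_real, hc.ae_notMem volume] with t hd ht hmem
  have hne : (𝓝[σ ⁻¹' segment ℝ v w ∩ Ioi t] t).NeBot := ⟨fun h => ht ⟨hmem, h⟩⟩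
  have hlim := (hasDerivAt_iff_tendsto_slope.1 hd.hasDerivAt).mono_left
    (nhdsWithin_mono t (s := σ ⁻¹' segment ℝ v w ∩ Ioi t) fun x hx => ne_of_gt hx.2)
  have hspan : deriv σ t ∈ Submodule.span ℝ {w - v} := by
    refine (Submodule.closed_of_finiteDimensional _).mem_of_tendsto hlim ?_
    filter_upwards [self_mem_nhdsWithin] with x hx
    have hsub : ∀ y ∈ segment ℝ v w, y - v ∈ Submodule.span ℝ {w - v} := by
      intro y hy
      rw [segment_eq_image'] at hy
      obtain ⟨r, -, rfl⟩ := hy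
      exact Submodule.mem_span_singleton.2 ⟨r, by simp⟩
    rw [slope_def_module]
    refine Submodule.smul_mem _ _ ?_
    have := Submodule.sub_mem _ (hsub _ hx.1) (hsub _ hmem)
    rwa [sub_sub_sub_cancel_right] at this
  obtain ⟨r, hr⟩ := Submodule.mem_span_singleton.1 hspan
  exact ⟨r * ‖w - v‖, by rw [mul_smul, norm_smul_unitVec, hr]⟩

/-! ### Length of connected sets and the equality case -/

open scoped NNReal ENNReal RealInnerProductSpace

/-- The distance from x is 1-Lipschitz and maps the connected set onto a set containing [0, dist x
y]. -/
theorem IsPreconnected.edist_le_hausdorffMeasure {X : Type*} [MetricSpace X] [MeasurableSpace X]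
    [BorelSpace X] {s : Set X} (hs : IsPreconnected s) {x y : X} (hx : x ∈ s) (hy : y ∈ s) :
    edist x y ≤ μH[1] s := by
  have hL : LipschitzWith 1 (dist x) := LipschitzWith.dist_right x
  have hsub : Icc 0 (dist x y) ⊆ dist x '' s := by
    have := (hs.image _ hL.continuous.continuousOn).Icc_subset
      (mem_image_of_mem _ hx) (mem_image_of_mem _ hy)
    rwa [dist_self] at this
  calc edist x y = volume (Icc 0 (dist x y)) := by
        rw [Real.volume_Icc, sub_zero, edist_dist]
    _ ≤ μH[1] (dist x '' s) := by
        rw [← hausdorffMeasure_real]; exact measure_mono hsub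
    _ ≤ μH[1] s := by simpa using hL.hausdorffMeasure_image_le zero_le_one s

/-- If a `1`-Lipschitz map does not decrease the measure of a set of finite measure, then the parts
on which it is a strict contraction are null. -/
theorem hausdorffMeasure_eq_zero_of_contraction {X Y : Type*} [MetricSpace X] [MeasurableSpace X]
    [BorelSpace X] [MetricSpace Y] [MeasurableSpace Y] [BorelSpace Y] {p : X → Y}
    (hp : LipschitzWith 1 p) {s t : Set X} (hle : μH[1] s ≤ μH[1] (p '' s))
    (hfin : μH[1] s ≠ ⊤) (ht : MeasurableSet t) (hts : t ⊆ s) {K : ℝ≥0} (hK : K < 1)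
    (hpt : LipschitzOnWith K p t) : μH[1] t = 0 := by
  have hsplit : μH[1] t + μH[1] (s \ t) = μH[1] s := by
    rw [← measure_inter_add_sdiff s ht, inter_eq_self_of_subset_right hts]
  have h1 : μH[1] (p '' t) ≤ K * μH[1] t := by
    simpa using hpt.hausdorffMeasure_image_le zero_le_one
  have h2 : μH[1] (p '' (s \ t)) ≤ μH[1] (s \ t) := by
    simpa using hp.hausdorffMeasure_image_le zero_le_one (s \ t)
  have h3 : μH[1] (p '' s) ≤ μH[1] (p '' t) + μH[1] (p '' (s \ t)) := by
    refine (measure_mono ?_).trans (measure_union_le _ _)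
    rw [← image_union, union_sdiff_cancel hts]
  have hd : μH[1] (s \ t) ≠ ⊤ := ne_top_of_le_ne_top hfin (measure_mono sdiff_subset)
  have htf : μH[1] t ≠ ⊤ := ne_top_of_le_ne_top hfin (measure_mono hts)
  -- The rest of s loses at best nothing, so cancelling its finite measure leaves all the loss on t.
  have h4 : μH[1] t ≤ K * μH[1] t := by
    refine (ENNReal.add_le_add_iff_right hd).1 ?_
    rw [hsplit]
    exact hle.trans (h3.trans (add_le_add h1 h2))
  by_contra h0
  refine (h4.trans_lt ?_).false
  calc (K : ℝ≥0∞) * μH[1] t < 1 * μH[1] t :=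
        ENNReal.mul_lt_mul_left h0 htf (by exact_mod_cast hK)
    _ = μH[1] t := one_mul _

theorem sq_norm_sub_inner_smul {E : Type*} [NormedAddCommGroup E] [InnerProductSpace ℝ E]
    {e : E} (he : ‖e‖ = 1) (w : E) : ‖w - ⟪e, w⟫ • e‖ ^ 2 = ‖w‖ ^ 2 - ⟪e, w⟫ ^ 2 := by
  rw [norm_sub_sq_real, inner_smul_right, norm_smul, he, real_inner_comm, Real.norm_eq_abs,
    mul_one, sq_abs]
  ring

/-- Strict Cauchy–Schwarz: w is not a multiple of e, because n annihilates e but not w. -/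
theorem abs_inner_lt_norm {E : Type*} [NormedAddCommGroup E] [InnerProductSpace ℝ E]
    {e n w : E} (he : ‖e‖ = 1) (hne : ⟪n, e⟫ = 0) (hw : ⟪n, w⟫ ≠ 0) : |⟪e, w⟫| < ‖w‖ := by
  have h0 : w - ⟪e, w⟫ • e ≠ 0 := by
    intro h
    apply hw
    rw [sub_eq_zero.1 h, inner_smul_right, hne, mul_zero]
  have h1 := sq_norm_sub_inner_smul he w
  have h2 : 0 < ‖w - ⟪e, w⟫ • e‖ ^ 2 := by positivity
  rw [← abs_norm w]
  exact sq_lt_sq.1 (by linarith)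

/-- A curve as short as the distance between its end points moves along the line through them. -/
theorem inner_sub_eq_zero_of_hausdorffMeasure_le {m : ℕ} {γ : ℝ → Euc m}
    (hc : ContinuousOn γ (Icc 0 1)) (hd : ∀ t ∈ Ioo (0 : ℝ) 1, DifferentiableAt ℝ γ t)
    (hle : μH[1] (γ '' Icc 0 1) ≤ edist (γ 0) (γ 1)) {n : Euc m} (hn : ⟪n, γ 1 - γ 0⟫ = 0)
    (hne : γ 0 ≠ γ 1) {t : ℝ} (ht : t ∈ Icc (0 : ℝ) 1) : ⟪n, γ t - γ 0⟫ = 0 := by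
  set I : Set (Euc m) := γ '' Icc 0 1
  have h0 : (0 : ℝ) ∈ Icc (0 : ℝ) 1 := by simp
  have h1 : (1 : ℝ) ∈ Icc (0 : ℝ) 1 := by simp
  have hIpre : IsPreconnected I := isPreconnected_Icc.image _ hc
  have hIcl : IsClosed I := (isCompact_Icc.image_of_continuousOn hc).isClosed
  set e := unitVec (γ 1 - γ 0) with he'
  have hv : γ 1 - γ 0 ≠ 0 := sub_ne_zero.2 hne.symm
  have he : ‖e‖ = 1 := norm_unitVec hv
  have hev : ‖γ 1 - γ 0‖ • e = γ 1 - γ 0 := norm_smul_unitVec _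
  have hnE : ⟪n, e⟫ = 0 := by rw [he', unitVec, inner_smul_right, hn, mul_zero]
  have hlip : ∀ v : Euc m, LipschitzWith ‖v‖₊ fun x : Euc m => ⟪v, x⟫ := fun v => by
    refine LipschitzWith.of_dist_le_mul fun x y => ?_
    rw [Real.dist_eq, ← inner_sub_right, dist_eq_norm]
    exact abs_real_inner_le_norm _ _
  have hp : LipschitzWith 1 fun x : Euc m => ⟪e, x⟫ := by
    simpa [show ‖e‖₊ = 1 from NNReal.eq he] using hlip e
  -- The projection of I contains an interval of length |γ 1 - γ 0|, which is at least ℋ¹(I).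
  have hexp : μH[1] I ≤ μH[1] ((fun x : Euc m => ⟪e, x⟫) '' I) := by
    refine hle.trans ?_
    have hsub := (hIpre.image _ hp.continuous.continuousOn).Icc_subset
      (mem_image_of_mem _ (mem_image_of_mem γ h0)) (mem_image_of_mem _ (mem_image_of_mem γ h1))
    refine le_trans (le_of_eq ?_) (measure_mono hsub)
    rw [hausdorffMeasure_real, Real.volume_Icc, ← inner_sub_right, edist_comm, edist_dist,
      dist_eq_norm]
    congr 1
    conv_rhs => rw [← hev, inner_smul_right, real_inner_self_eq_norm_sq, he]
    simp
  have hfin : μH[1] I ≠ ⊤ := ne_top_of_le_ne_top (edist_ne_top _ _) hle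
  let f : ℝ → ℝ := fun s => ⟪n, γ s⟫
  have hf : ∀ s ∈ Ioo (0 : ℝ) 1, HasDerivAt f ⟪n, deriv γ s⟫ s := fun s hs => by
    simpa using (hasDerivAt_const s n).inner ℝ (hd s hs).hasDerivAt
  -- The aim is that f has null range: on Z by Sard's argument in one dimension, on A because the
  -- projection to e contracts pieces of the curve.
  let A : Set ℝ := {s ∈ Ioo (0 : ℝ) 1 | ⟪n, deriv γ s⟫ ≠ 0}
  let Z : Set ℝ := {s ∈ Ioo (0 : ℝ) 1 | ⟪n, deriv γ s⟫ = 0}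
  have hZ : volume (f '' Z) = 0 := by
    refine addHaar_image_eq_zero_of_det_fderivWithin_eq_zero volume (f' := fun _ => 0)
      (fun s hs => ?_) fun s hs => by simp
    have hfs : HasDerivAt f 0 s := hs.2 ▸ hf s hs.1
    simpa using hfs.hasFDerivAt.hasFDerivWithinAt (s := Z)
  have hA : volume (f '' A) = 0 := by
    -- A quarter of the gap keeps |⟪e, w⟫| + ρ below ‖w‖ - ρ, so the ratio is a contraction
    -- constant. The value 1 only serves to be nonzero.
    let r : (ℝ →L[ℝ] Euc m) → ℝ≥0 := fun B =>
      if |⟪e, B 1⟫| < ‖B 1‖ then Real.toNNReal ((‖B 1‖ - |⟪e, B 1⟫|) / 4) else 1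
    have hr : ∀ B, r B ≠ 0 := fun B => by
      simp only [r]
      split_ifs with h
      · simp only [ne_eq, Real.toNNReal_eq_zero, not_le]; linarith
      · exact one_ne_zero
    obtain ⟨u, B, -, hcov, happ, hB⟩ := exists_closed_cover_approximatesLinearOn_of_hasFDerivWithinAt
      γ A (fun s => fderiv ℝ γ s)
      (fun s hs => (hd s hs.1).hasFDerivAt.hasFDerivWithinAt) r hr
    rcases A.eq_empty_or_nonempty with hAe | hAne
    · simp [hAe]
    have hsub : f '' A ⊆ ⋃ k, f '' (A ∩ u k) := by
      rw [← image_iUnion, ← inter_iUnion, inter_eq_self_of_subset_left hcov]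
    refine measure_mono_null hsub (measure_iUnion_null fun k => ?_)
    obtain ⟨s, hs, hBs⟩ := hB hAne k
    have hB1 : B k 1 = deriv γ s := by rw [hBs]; simp
    have hlt : |⟪e, B k 1⟫| < ‖B k 1‖ := by
      rw [hB1]; exact abs_inner_lt_norm he hnE hs.2
    set w := B k 1 with hw
    set ρ : ℝ := (‖w‖ - |⟪e, w⟫|) / 4 with hρ
    have hrk : (r (B k) : ℝ) = ρ := by
      simp only [r, ← hw, if_pos hlt]
      exact Real.coe_toNNReal _ (by linarith)
    have hρ0 : 0 < ρ := by linarith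
    have hden : 0 < ‖w‖ - ρ := by have := abs_nonneg ⟪e, w⟫; linarith
    have hK0 : 0 ≤ (|⟪e, w⟫| + ρ) / (‖w‖ - ρ) := by positivity
    let K : ℝ≥0 := ⟨(|⟪e, w⟫| + ρ) / (‖w‖ - ρ), hK0⟩
    have hK1 : K < 1 := by
      rw [← NNReal.coe_lt_coe]
      change (|⟪e, w⟫| + ρ) / (‖w‖ - ρ) < 1
      rw [div_lt_one hden]; linarith
    have hcontr : LipschitzOnWith K (fun x : Euc m => ⟪e, x⟫) (γ '' (A ∩ u k)) := by
      refine LipschitzOnWith.of_dist_le_mul ?_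
      rintro _ ⟨a, ha, rfl⟩ _ ⟨b, hb, rfl⟩
      have hap := happ k a ha b hb
      rw [hrk, show B k (a - b) = (a - b) • w by
        rw [hw, ← map_smul, smul_eq_mul, mul_one], Real.norm_eq_abs] at hap
      set z := γ a - γ b - (a - b) • w with hz
      have hγ : γ a - γ b = (a - b) • w + z := by rw [hz]; abel
      have hup : |⟪e, γ a - γ b⟫| ≤ (|⟪e, w⟫| + ρ) * |a - b| := by
        rw [hγ, inner_add_right, inner_smul_right]
        have := abs_real_inner_le_norm e z
        rw [he, one_mul] at this
        calc |(a - b) * ⟪e, w⟫ + ⟪e, z⟫| ≤ |(a - b) * ⟪e, w⟫| + |⟪e, z⟫| := abs_add_le _ _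
          _ ≤ |a - b| * |⟪e, w⟫| + ρ * |a - b| := by rw [abs_mul]; linarith
          _ = _ := by ring
      have hlow : (‖w‖ - ρ) * |a - b| ≤ ‖γ a - γ b‖ := by
        have := norm_sub_le ((a - b) • w + z) z
        rw [add_sub_cancel_right, ← hγ, norm_smul, Real.norm_eq_abs] at this
        linarith
      rw [Real.dist_eq, ← inner_sub_right, dist_eq_norm]
      change _ ≤ (|⟪e, w⟫| + ρ) / (‖w‖ - ρ) * _
      rw [div_mul_eq_mul_div, le_div_iff₀ hden]
      calc |⟪e, γ a - γ b⟫| * (‖w‖ - ρ) ≤ (|⟪e, w⟫| + ρ) * |a - b| * (‖w‖ - ρ) := by gcongr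
        _ = (|⟪e, w⟫| + ρ) * ((‖w‖ - ρ) * |a - b|) := by ring
        _ ≤ _ := by gcongr
    -- Passing to the closure supplies measurability; the Lipschitz bound extends to it.
    have hJI : closure (γ '' (A ∩ u k)) ⊆ I := closure_minimal
      (image_mono (inter_subset_left.trans fun x hx => Ioo_subset_Icc_self hx.1)) hIcl
    have hJ : μH[1] (closure (γ '' (A ∩ u k))) = 0 :=
      hausdorffMeasure_eq_zero_of_contraction hp hexp hfin isClosed_closure.measurableSet hJI hK1
        (hcontr.closure hp.continuous.continuousOn)
    have hJ' : μH[1] (γ '' (A ∩ u k)) = 0 := measure_mono_null subset_closure hJ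
    have := (hlip n).hausdorffMeasure_image_le zero_le_one (γ '' (A ∩ u k))
    rw [hJ', mul_zero, image_image, hausdorffMeasure_real] at this
    exact le_antisymm this zero_le
  have hnull : volume (f '' Icc 0 1) = 0 := by
    have hsub : f '' Icc 0 1 ⊆ ({f 0, f 1} ∪ f '' Z) ∪ f '' A := by
      rintro _ ⟨s, hs, rfl⟩
      rcases eq_or_lt_of_le hs.1 with h | hs0
      · left; left; simp [← h]
      rcases eq_or_lt_of_le hs.2 with h | hs1
      · left; left; simp [h]
      by_cases h : ⟪n, deriv γ s⟫ = 0
      · exact Or.inl (Or.inr ⟨s, ⟨⟨hs0, hs1⟩, h⟩, rfl⟩)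
      · exact Or.inr ⟨s, ⟨⟨hs0, hs1⟩, h⟩, rfl⟩
    exact measure_mono_null hsub
      (measure_union_null (measure_union_null ((toFinite _).measure_zero _) hZ) hA)
  have hfc : ContinuousOn f (Icc 0 1) := continuousOn_const.inner hc
  -- A null connected subset of the line has only one point.
  have := (isPreconnected_Icc.image f hfc).edist_le_hausdorffMeasure
    (mem_image_of_mem f ht) (mem_image_of_mem f h0)
  rw [hausdorffMeasure_real, hnull, nonpos_iff_eq_zero, edist_eq_zero] at this
  rw [inner_sub_right, sub_eq_zero]
  exact this

/-- The orthogonal component n of γ t - γ 0 is itself an admissible normal, hence orthogonal to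
itself and zero. So the image lies on the line. Connectedness makes it contain the segment; having
diameter at most |γ 1 - γ 0| keeps it from extending beyond either end. -/
theorem image_eq_segment_of_hausdorffMeasure_le {m : ℕ} {γ : ℝ → Euc m}
    (hc : ContinuousOn γ (Icc 0 1)) (hd : ∀ t ∈ Ioo (0 : ℝ) 1, DifferentiableAt ℝ γ t)
    (hle : μH[1] (γ '' Icc 0 1) ≤ edist (γ 0) (γ 1)) :
    segment ℝ (γ 0) (γ 1) = γ '' Icc 0 1 := by
  have h0 : γ 0 ∈ γ '' Icc 0 1 := mem_image_of_mem γ (by simp)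
  have h1 : γ 1 ∈ γ '' Icc 0 1 := mem_image_of_mem γ (by simp)
  have hpre : IsPreconnected (γ '' Icc 0 1) := isPreconnected_Icc.image _ hc
  have hdist : ∀ x ∈ γ '' Icc 0 1, ∀ y ∈ γ '' Icc 0 1, ‖x - y‖ ≤ ‖γ 1 - γ 0‖ := by
    intro x hx y hy
    have := (hpre.edist_le_hausdorffMeasure hx hy).trans hle
    rwa [edist_dist, edist_dist, ENNReal.ofReal_le_ofReal_iff dist_nonneg, dist_eq_norm,
      dist_eq_norm, norm_sub_rev (γ 0)] at this
  by_cases hne : γ 0 = γ 1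
  · rw [← hne, segment_same]
    refine (subset_antisymm (fun x hx => ?_) (singleton_subset_iff.2 h0)).symm
    have := hdist x hx _ h0
    rw [← hne, sub_self, norm_zero] at this
    exact sub_eq_zero.1 (norm_le_zero_iff.1 this)
  have hv : γ 1 - γ 0 ≠ 0 := sub_ne_zero.2 (Ne.symm hne)
  have hv0 : 0 < ‖γ 1 - γ 0‖ := norm_pos_iff.2 hv
  set v := γ 1 - γ 0 with hvdef
  let a : Euc m → ℝ := fun x => ⟪v, x - γ 0⟫ / ‖v‖ ^ 2
  have hline : ∀ x ∈ γ '' Icc 0 1, x = γ 0 + a x • v := by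
    rintro _ ⟨t, ht, rfl⟩
    set n := γ t - γ 0 - a (γ t) • v with hn
    have hnv : ⟪n, v⟫ = 0 := by
      rw [hn, inner_sub_left, inner_smul_left, real_inner_self_eq_norm_sq, real_inner_comm]
      simp only [a, conj_trivial]
      field_simp
      ring
    have h := inner_sub_eq_zero_of_hausdorffMeasure_le hc hd hle hnv hne ht
    have hnn : ⟪n, n⟫ = 0 := by
      conv_lhs => rw [hn, inner_sub_right, ← hn]
      rw [h, inner_smul_right, hnv]; simp
    have hn0 := inner_self_eq_zero.1 hnn
    rw [hn, sub_sub, sub_eq_zero] at hn0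
    exact hn0
  have ha0 : a (γ 0) = 0 := by simp [a]
  have ha1 : a (γ 1) = 1 := by
    simp only [a, ← hvdef, real_inner_self_eq_norm_sq]
    field_simp
  have hac : Continuous a := by fun_prop
  rw [segment_eq_image']
  ext x
  constructor
  · rintro ⟨s, hs, rfl⟩
    have := (hpre.image a hac.continuousOn).Icc_subset (mem_image_of_mem a h0)
      (mem_image_of_mem a h1)
    rw [ha0, ha1] at this
    obtain ⟨y, hy, hys⟩ := this hs
    have hyl := hline y hy
    rw [hys] at hyl
    change γ 0 + s • v ∈ _
    rwa [← hyl]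
  · intro hx
    have hxl := hline x hx
    refine ⟨a x, ⟨?_, ?_⟩, hxl.symm⟩
    · have := hdist x hx _ h1
      rw [hxl, show γ 0 + a x • v - γ 1 = (a x - 1) • v by rw [sub_smul, one_smul, hvdef]; abel,
        norm_smul, Real.norm_eq_abs, mul_le_iff_le_one_left hv0] at this
      linarith [(abs_le.1 this).1]
    · have := hdist x hx _ h0
      rw [hxl, add_sub_cancel_left, norm_smul, Real.norm_eq_abs,
        mul_le_iff_le_one_left hv0] at this
      exact (abs_le.1 this).2

/-! ### The cost density -/

theorem capCost_add_int_mul {c : ℝ} (hc : 0 < c) (α x : ℝ) (k : ℤ) :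
    capCost α c (x + k * c) = capCost α c x + k := by
  have h : (x + k * c) / c = x / c + k := by field_simp
  rw [capCost, capCost, h, Int.floor_add_intCast, Int.fract_add_intCast, Int.cast_add]
  ring

theorem capCost_nonneg {α c x : ℝ} (hc : 0 < c) (hx : 0 ≤ x) : 0 ≤ capCost α c x := by
  have h1 : (0 : ℝ) ≤ ⌊x / c⌋ := by exact_mod_cast Int.floor_nonneg.2 (by positivity)
  have h2 := Real.rpow_nonneg (Int.fract_nonneg (x / c)) α
  unfold capCost
  split_ifs <;> linarith

/-- Between consecutive integers this is monotonicity of the power; across an integer, the jump of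
the floor outweighs a fractional term of at most 1. -/
theorem capCost_mono {α c : ℝ} (hα : 0 ≤ α) (hc : 0 < c) : Monotone (capCost α c) := by
  intro x y hxy
  have hab : x / c ≤ y / c := by gcongr
  unfold capCost
  generalize x / c = a at hab ⊢
  generalize y / c = b at hab ⊢
  have ha := Int.fract_nonneg a
  have hb := Int.fract_nonneg b
  have hapow : (if Int.fract a = 0 then 0 else Int.fract a ^ α) ≤ 1 := by
    split_ifs
    · exact zero_le_one
    · exact Real.rpow_le_one ha (Int.fract_lt_one a).le hα
  have hbpow : 0 ≤ if Int.fract b = 0 then 0 else Int.fract b ^ α := by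
    split_ifs
    · exact le_rfl
    · exact Real.rpow_nonneg hb α
  rcases (Int.floor_mono hab).eq_or_lt with h | h
  · have hf : Int.fract a ≤ Int.fract b := by
      rw [Int.fract, Int.fract, h]; linarith
    rw [h]
    gcongr
    by_cases ha0 : Int.fract a = 0
    · rwa [if_pos ha0]
    · have hb0 : Int.fract b ≠ 0 := ((lt_of_le_of_ne ha (Ne.symm ha0)).trans_le hf).ne'
      rw [if_neg ha0, if_neg hb0]
      exact Real.rpow_le_rpow ha hf hα
  · have : (⌊a⌋ : ℝ) + 1 ≤ ⌊b⌋ := by exact_mod_cast h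
    linarith

/-! ### Currents of curves and segments -/

/-- Test forms integrate locally integrable fields. -/
theorem OneForm.integrable_apply {m : ℕ} (ω : OneForm m) {W : Euc m → Euc m}
    {μ : Measure (Euc m)} (hW : LocallyIntegrable W μ) : Integrable (fun x => ω x (W x)) μ :=
  TestFunction.integrable_bilin (ContinuousLinearMap.id ℝ (Euc m →L[ℝ] ℝ))
    (hW.locallyIntegrableOn _) ω

theorem tau_one_apply {m : ℕ} {A : Set (Euc m)} (hA : MeasurableSet A) {ζ η : Euc m → Euc m}
    (h : ζ =ᵐ[μH[1].restrict A] η) (hη : LocallyIntegrable η (μH[1].restrict A))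
    (ω : OneForm m) :
    tau A (fun _ => 1) ζ ω = ∫ x, ω x (A.indicator η x) ∂μH[1] := by
  have hζ : LocallyIntegrable (fun x => (1 : ℝ) • ζ x) (μH[1].restrict A) := by
    simpa using hη.congr h.symm
  have hind : (fun x => ω x (A.indicator η x)) = A.indicator fun x => ω x (η x) := by
    ext x
    by_cases hx : x ∈ A <;> simp [hx]
  rw [tau_apply _ _ _ hζ, hind, integral_indicator hA]
  refine integral_congr_ae ?_
  filter_upwards [h] with x hx
  rw [one_mul, hx]

theorem ae_exists_mem_Ioo {m : ℕ} (γ : ℝ → Euc m) (hm : MeasurableSet (γ '' Icc (0 : ℝ) 1)) :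
    ∀ᵐ x ∂(μH[1].restrict (γ '' Icc (0 : ℝ) 1)), ∃ t ∈ Ioo (0 : ℝ) 1, γ t = x := by
  have : NullSingletonClass (μH[1] : Measure (Euc m)) :=
    Measure.nullSingletonClass_hausdorff _ one_pos
  have h0 : ∀ y : Euc m, ∀ᵐ x ∂(μH[1].restrict (γ '' Icc (0 : ℝ) 1)), x ≠ y := fun y =>
    ae_restrict_of_ae (by simp [ae_iff])
  filter_upwards [ae_restrict_mem hm, h0 (γ 0), h0 (γ 1)] with x hx hx0 hx1
  obtain ⟨t, ht, rfl⟩ := hx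
  refine ⟨t, ⟨lt_of_le_of_ne ht.1 ?_, lt_of_le_of_ne ht.2 ?_⟩, rfl⟩
  · rintro rfl; exact hx0 rfl
  · rintro rfl; exact hx1 rfl

theorem curveDirection_ae_eq {m : ℕ} {γ : ℝ → Euc m} {ξ : Euc m → Euc m}
    (hm : MeasurableSet (γ '' Icc (0 : ℝ) 1)) (h : RunsAlong γ ξ) :
    curveDirection γ =ᵐ[μH[1].restrict (γ '' Icc (0 : ℝ) 1)] ξ := by
  filter_upwards [h, ae_exists_mem_Ioo γ hm] with x hx hex
  rw [curveDirection, dif_pos hex]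
  exact hx _ hex.choose_spec.1 hex.choose_spec.2

/-- A regular curve whose image is the segment between its end points runs in the direction of the
segment. -/
theorem unitVec_deriv_of_image_eq_segment {m : ℕ} {γ : ℝ → Euc m}
    (hc : ContinuousOn γ (Icc 0 1)) (hd : ∀ t ∈ Ioo (0 : ℝ) 1, DifferentiableAt ℝ γ t)
    (hne : ∀ t ∈ Ioo (0 : ℝ) 1, deriv γ t ≠ 0)
    (hseg : segment ℝ (γ 0) (γ 1) = γ '' Icc 0 1) {t : ℝ} (ht : t ∈ Ioo (0 : ℝ) 1) :
    unitVec (deriv γ t) = unitVec (γ 1 - γ 0) := by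
  set v := γ 1 - γ 0 with hv
  let f : ℝ → ℝ := fun s => ⟪v, γ s - γ 0⟫ / ‖v‖ ^ 2
  have hf : ∀ s ∈ Ioo (0 : ℝ) 1, HasDerivAt f (⟪v, deriv γ s⟫ / ‖v‖ ^ 2) s := fun s hs => by
    have := ((hasDerivAt_const s v).inner ℝ ((hd s hs).hasDerivAt.sub_const (γ 0))).div_const
      (‖v‖ ^ 2)
    simpa using this
  have hline : ∀ s ∈ Icc (0 : ℝ) 1, γ s = γ 0 + f s • v := by
    intro s hs
    have hmem : γ s ∈ segment ℝ (γ 0) (γ 1) := hseg ▸ mem_image_of_mem γ hs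
    rw [segment_eq_image'] at hmem
    obtain ⟨r, -, hr⟩ := hmem
    change γ 0 + r • v = γ s at hr
    by_cases hv0 : v = 0
    · rw [← hr, hv0]; simp
    have hv1 : ‖v‖ ≠ 0 := norm_ne_zero_iff.2 hv0
    have : f s = r := by
      simp only [f]
      rw [← hr, add_sub_cancel_left, inner_smul_right, real_inner_self_eq_norm_sq]
      field_simp
    rw [this, hr]
  have hder : ∀ s ∈ Ioo (0 : ℝ) 1, deriv γ s = (⟪v, deriv γ s⟫ / ‖v‖ ^ 2) • v := by
    intro s hs
    have h1 : HasDerivAt (fun s => γ 0 + f s • v) ((⟪v, deriv γ s⟫ / ‖v‖ ^ 2) • v) s :=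
      ((hf s hs).smul_const v).const_add _
    refine (h1.congr_of_eventuallyEq ?_).deriv
    filter_upwards [Ioo_mem_nhds hs.1 hs.2] with r hr
    exact hline r (Ioo_subset_Icc_self hr)
  have hv0 : v ≠ 0 := fun h => hne t ht (by rw [hder t ht, h, smul_zero])
  have hv1 : ‖v‖ ≠ 0 := norm_ne_zero_iff.2 hv0
  have hfne : ∀ s ∈ Ioo (0 : ℝ) 1, ⟪v, deriv γ s⟫ / ‖v‖ ^ 2 ≠ 0 := fun s hs h =>
    hne s hs (by rw [hder s hs, h, zero_smul])
  have hfc : ContinuousOn f (Icc 0 1) :=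
    (continuousOn_const.inner (hc.sub continuousOn_const)).div_const _
  -- By Darboux, the nonvanishing derivative of the coordinate f has constant sign; f 0 = 0 and f 1
  -- = 1 exclude the negative one.
  rcases hasDerivWithinAt_forall_lt_or_forall_gt_of_forall_ne (convex_Ioo (0 : ℝ) 1)
    (fun s hs => (hf s hs).hasDerivWithinAt) hfne with hneg | hpos
  · have hanti : StrictAntiOn f (Icc 0 1) := by
      refine strictAntiOn_of_deriv_neg (convex_Icc 0 1) hfc fun s hs => ?_
      rw [interior_Icc] at hs
      rw [(hf s hs).deriv]
      exact hneg s hs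
    have h01 := hanti (left_mem_Icc.2 zero_le_one) (right_mem_Icc.2 zero_le_one) zero_lt_one
    have hf0 : f 0 = 0 := by simp [f]
    have hf1 : f 1 = 1 := by
      simp only [f, ← hv, real_inner_self_eq_norm_sq]
      field_simp
    linarith
  · rw [hder t ht, unitVec_smul_of_pos (hpos t ht)]

theorem curveCurrent_eq_segmentCurrent {m : ℕ} {γ : ℝ → Euc m}
    (hc : ContinuousOn γ (Icc 0 1)) (hd : ∀ t ∈ Ioo (0 : ℝ) 1, DifferentiableAt ℝ γ t)
    (hne : ∀ t ∈ Ioo (0 : ℝ) 1, deriv γ t ≠ 0)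
    (hseg : segment ℝ (γ 0) (γ 1) = γ '' Icc 0 1) :
    curveCurrent γ = segmentCurrent (γ 0) (γ 1) := by
  have hm : MeasurableSet (γ '' Icc (0 : ℝ) 1) :=
    (isCompact_Icc.image_of_continuousOn hc).measurableSet
  have hae : curveDirection γ =ᵐ[μH[1].restrict (γ '' Icc (0 : ℝ) 1)]
      fun _ => unitVec (γ 1 - γ 0) := by
    filter_upwards [ae_exists_mem_Ioo γ hm] with x hex
    rw [curveDirection, dif_pos hex]
    exact unitVec_deriv_of_image_eq_segment hc hd hne hseg hex.choose_spec.1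
  have hfin : IsFiniteMeasure (μH[1].restrict (γ '' Icc (0 : ℝ) 1)) := by
    rw [isFiniteMeasure_restrict, ← hseg, hausdorffMeasure_segment]
    exact edist_ne_top _ _
  have hint : LocallyIntegrable (fun _ : Euc m => unitVec (γ 1 - γ 0))
      (μH[1].restrict (γ '' Icc (0 : ℝ) 1)) := (integrable_const _).locallyIntegrable
  rw [curveCurrent, segmentCurrent, hseg]
  ext ω
  rw [tau_one_apply hm hae hint, tau_one_apply hm (ae_eq_refl _) hint]

/-! ### Rerouting flux from the curve to the segment -/

section Reroute

variable {m : ℕ} (T : RectData m) (v₁ v₂ : Euc m) (I : Set (Euc m)) (a : ℝ)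

/-- The field of `T` with flux `a` removed along `I` and added along the segment `v₁ v₂`. -/
noncomputable def reroutedField (x : Euc m) : Euc m :=
  T.field x + a • (segment ℝ v₁ v₂).indicator (fun _ => unitVec (v₂ - v₁)) x -
    a • I.indicator T.direction x

variable {T v₁ v₂ I a}

theorem measurableSet_segment : MeasurableSet (segment ℝ v₁ v₂) := by
  rw [segment_eq_image_lineMap]
  exact (isCompact_Icc.image AffineMap.lineMap_continuous).measurableSet

theorem locallyIntegrable_segment : LocallyIntegrable (fun _ => unitVec (v₂ - v₁))
    (μH[1].restrict (segment ℝ v₁ v₂)) := by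
  have hfin : IsFiniteMeasure (μH[1].restrict (segment ℝ v₁ v₂)) := by
    rw [isFiniteMeasure_restrict, hausdorffMeasure_segment]
    exact edist_ne_top _ _
  exact (integrable_const _).locallyIntegrable

theorem locallyIntegrable_direction (hIT : I ⊆ T.carrier) (hI : μH[1] I ≠ ⊤) :
    LocallyIntegrable T.direction (μH[1].restrict I) := by
  have hle := Measure.restrict_mono hIT (le_refl (μH[1] : Measure (Euc m)))
  have hfin : IsFiniteMeasure (μH[1].restrict I) := isFiniteMeasure_restrict.2 hI
  refine ((integrable_const (1 : ℝ)).mono (T.direction_measurable.mono_measure hle)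
    ?_).locallyIntegrable
  filter_upwards [ae_mono hle T.direction_unit] with x hx
  simp [hx]

theorem reroutedField_locallyIntegrable (hIT : I ⊆ T.carrier) (hIm : MeasurableSet I)
    (hI : μH[1] I ≠ ⊤) : LocallyIntegrable (reroutedField T v₁ v₂ I a) μH[1] :=
  (T.field_locallyIntegrable.add ((locallyIntegrable_segment.indicator_of_restrict
    measurableSet_segment.nullMeasurableSet).smul a)).sub
    (((locallyIntegrable_direction hIT hI).indicator_of_restrict hIm.nullMeasurableSet).smul a)

theorem support_reroutedField_subset (hIT : I ⊆ T.carrier) :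
    Function.support (reroutedField T v₁ v₂ I a) ⊆ T.carrier ∪ segment ℝ v₁ v₂ := by
  intro x hx
  by_contra h
  rw [mem_union, not_or] at h
  have hxI : x ∉ I := fun h' => h.1 (hIT h')
  exact hx (by simp [reroutedField, RectData.field, h.1, h.2, hxI])

/-- At almost every time with nonzero velocity, each direction present at σ t is a multiple of σ',
even where I and the segment overlap; hence so is their combination. -/
theorem isTangentField_reroutedField (hIT : I ⊆ T.carrier) :
    IsTangentField (Function.support (reroutedField T v₁ v₂ I a))
      (reroutedField T v₁ v₂ I a) := by
  intro σ hσ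
  filter_upwards [T.direction_tangent σ hσ, isTangentField_segment v₁ v₂ σ hσ] with t h1 h2 ht
  by_cases hd : deriv σ t = 0
  · exact ⟨0, by rw [hd, zero_smul]⟩
  have hpar : ∀ w : Euc m, (∃ s : ℝ, deriv σ t = s • w) → ∃ r : ℝ, w = r • deriv σ t := by
    rintro w ⟨s, hs⟩
    have hs0 : s ≠ 0 := by rintro rfl; exact hd (by rw [hs, zero_smul])
    exact ⟨s⁻¹, by rw [hs, inv_smul_smul₀ hs0]⟩
  have hM : ∃ r : ℝ, T.carrier.indicator T.direction (σ t) = r • deriv σ t := by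
    by_cases hx : σ t ∈ T.carrier
    · simpa [hx] using hpar _ (h1 hx)
    · exact ⟨0, by simp [hx]⟩
  have hS : ∃ r : ℝ, (segment ℝ v₁ v₂).indicator (fun _ => unitVec (v₂ - v₁)) (σ t) =
      r • deriv σ t := by
    by_cases hx : σ t ∈ segment ℝ v₁ v₂
    · simpa [hx] using hpar _ (h2 hx)
    · exact ⟨0, by simp [hx]⟩
  obtain ⟨r, hr⟩ := hM
  obtain ⟨q, hq⟩ := hS
  have hF : T.field (σ t) = (T.density (σ t) * r) • deriv σ t := by
    rw [mul_smul, ← hr]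
    by_cases hx : σ t ∈ T.carrier <;> simp [RectData.field, hx]
  have hI : ∃ p : ℝ, I.indicator T.direction (σ t) = p • deriv σ t := by
    by_cases hx : σ t ∈ I
    · exact ⟨r, by rw [← hr]; simp [hx, hIT hx]⟩
    · exact ⟨0, by simp [hx]⟩
  obtain ⟨p, hp⟩ := hI
  have hW : reroutedField T v₁ v₂ I a (σ t) =
      (T.density (σ t) * r + a * q - a * p) • deriv σ t := by
    rw [reroutedField, hF, hq, hp, sub_smul, add_smul, mul_smul a, mul_smul a]
  set k := T.density (σ t) * r + a * q - a * p
  have hk : k ≠ 0 := by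
    intro h
    rw [h, zero_smul] at hW
    exact ht hW
  exact ⟨k⁻¹, by rw [hW, inv_smul_smul₀ hk]⟩

/-- The data of the rerouted current. -/
noncomputable def RectData.reroute (T : RectData m) (v₁ v₂ : Euc m) {I : Set (Euc m)} (a : ℝ)
    (hIT : I ⊆ T.carrier) (hIm : MeasurableSet I) (hI : μH[1] I ≠ ⊤) : RectData m :=
  RectData.ofField (reroutedField T v₁ v₂ I a) (reroutedField_locallyIntegrable hIT hIm hI)
    ((T.rectifiable.union_segment v₁ v₂).mono (support_reroutedField_subset hIT))
    (isTangentField_reroutedField hIT)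

theorem RectData.field_reroute (hIT : I ⊆ T.carrier) (hIm : MeasurableSet I)
    (hI : μH[1] I ≠ ⊤) : (T.reroute v₁ v₂ a hIT hIm hI).field = reroutedField T v₁ v₂ I a :=
  RectData.field_ofField _ _ _ _

theorem RectData.current_reroute (hIT : I ⊆ T.carrier) (hIm : MeasurableSet I)
    (hI : μH[1] I ≠ ⊤) {ζ : Euc m → Euc m} (hζ : ζ =ᵐ[μH[1].restrict I] T.direction) :
    (T.reroute v₁ v₂ a hIT hIm hI).current =
      T.current + a • segmentCurrent v₁ v₂ - a • tau I (fun _ => 1) ζ := by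
  ext ω
  have hS := locallyIntegrable_segment (v₁ := v₁) (v₂ := v₂)
  have hD := locallyIntegrable_direction hIT hI
  have hS' := ω.integrable_apply
    (hS.indicator_of_restrict measurableSet_segment.nullMeasurableSet)
  have hD' := ω.integrable_apply (hD.indicator_of_restrict hIm.nullMeasurableSet)
  have hT' := ω.integrable_apply T.field_locallyIntegrable
  have hTS : Integrable (fun x => ω x (T.field x) +
      a * ω x ((segment ℝ v₁ v₂).indicator (fun _ => unitVec (v₂ - v₁)) x)) μH[1] :=
    hT'.add (hS'.const_mul a)
  simp only [sub_apply, add_apply, smul_apply, smul_eq_mul]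
  rw [current_apply, field_reroute, current_apply, segmentCurrent,
    tau_one_apply measurableSet_segment (ae_eq_refl _) hS, tau_one_apply hIm hζ hD,
    ← integral_const_mul, ← integral_const_mul, ← integral_add hT' (hS'.const_mul a),
    ← integral_sub hTS (hD'.const_mul a)]
  simp [reroutedField]

/-- On I the removed flux is parallel to the field and no larger, so the norm drops by exactly kc;
the segment adds at most kc. Integer-valued indicators make `capCost_add_int_mul` applicable
pointwise. -/
theorem norm_reroutedField_le {k : ℤ} {c : ℝ} (hk : 0 ≤ k) (hc : 0 < c) (hIT : I ⊆ T.carrier)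
    (hθ : ∀ x ∈ I, k * c ≤ T.density x) {x : Euc m}
    (hx : x ∈ T.carrier → ‖T.direction x‖ = 1) :
    ‖reroutedField T v₁ v₂ I (k * c) x‖ ≤ ‖T.field x‖ +
      (((segment ℝ v₁ v₂).indicator (fun _ => k) x - I.indicator (fun _ => k) x : ℤ) : ℝ) * c := by
  have hkc : 0 ≤ k * c := mul_nonneg (by exact_mod_cast hk) hc.le
  have hmain : ‖T.field x - ((k : ℝ) * c) • I.indicator T.direction x‖ ≤
      ‖T.field x‖ - (I.indicator (fun _ => k) x : ℤ) * c := by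
    by_cases hxI : x ∈ I
    · have hxT := hIT hxI
      have hpos := T.density_pos x hxT
      have h := hθ x hxI
      simp only [RectData.field, indicator_of_mem hxT, indicator_of_mem hxI]
      rw [← sub_smul, norm_smul, norm_smul, hx hxT, Real.norm_of_nonneg (sub_nonneg.2 h),
        Real.norm_of_nonneg hpos.le, mul_one, mul_one]
    · simp [hxI]
  have hseg : ‖((k : ℝ) * c) • (segment ℝ v₁ v₂).indicator (fun _ => unitVec (v₂ - v₁)) x‖ ≤
      ((segment ℝ v₁ v₂).indicator (fun _ => k) x : ℤ) * c := by
    by_cases hxS : x ∈ segment ℝ v₁ v₂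
    · simp only [indicator_of_mem hxS]
      rw [norm_smul, Real.norm_of_nonneg hkc]
      by_cases hv : v₂ - v₁ = 0
      · simpa [hv, unitVec] using hkc
      · rw [norm_unitVec hv, mul_one]
    · simp [hxS]
  have := norm_add_le (T.field x - ((k : ℝ) * c) • I.indicator T.direction x)
    (((k : ℝ) * c) • (segment ℝ v₁ v₂).indicator (fun _ => unitVec (v₂ - v₁)) x)
  rw [reroutedField, add_sub_right_comm]
  push_cast
  linarith

/-- Lengths are added on both sides to avoid subtraction in `ENNReal`, so no finiteness is needed.
-/
theorem lintegral_capCost_reroute_le {α c : ℝ} (hα : 0 ≤ α) {k : ℤ} (hk : 0 ≤ k) (hc : 0 < c)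
    (hIT : I ⊆ T.carrier) (hIm : MeasurableSet I) (hθ : ∀ x ∈ I, k * c ≤ T.density x) :
    (∫⁻ x, ENNReal.ofReal (capCost α c ‖reroutedField T v₁ v₂ I (k * c) x‖) ∂μH[1]) +
        ENNReal.ofReal k * μH[1] I ≤
      (∫⁻ x, ENNReal.ofReal (capCost α c ‖T.field x‖) ∂μH[1]) +
        ENNReal.ofReal k * edist v₁ v₂ := by
  rw [← hausdorffMeasure_segment v₁ v₂, ← lintegral_indicator_const hIm,
    ← lintegral_indicator_const measurableSet_segment,
    ← lintegral_add_right _ (measurable_const.indicator hIm),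
    ← lintegral_add_right _ (measurable_const.indicator measurableSet_segment)]
  refine lintegral_mono_ae ?_
  filter_upwards [(ae_restrict_iff'₀ T.nullMeasurable).1 T.direction_unit] with x hx
  have hle := (capCost_mono hα hc (norm_reroutedField_le (v₁ := v₁) (v₂ := v₂)
    hk hc hIT hθ hx)).trans_eq (capCost_add_int_mul hc α _ _)
  have hW : 0 ≤ capCost α c ‖reroutedField T v₁ v₂ I (k * c) x‖ :=
    capCost_nonneg hc (norm_nonneg _)
  have hF : 0 ≤ capCost α c ‖T.field x‖ := capCost_nonneg hc (norm_nonneg _)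
  have hind : ∀ A : Set (Euc m), A.indicator (fun _ => ENNReal.ofReal k) x =
      ENNReal.ofReal (A.indicator (fun _ => k) x : ℤ) := fun A => by
    by_cases h : x ∈ A <;> simp [h]
  have hnn : ∀ A : Set (Euc m), (0 : ℝ) ≤ (A.indicator (fun _ => k) x : ℤ) := fun A => by
    by_cases h : x ∈ A <;> simp [h, hk]
  rw [hind, hind, ← ENNReal.ofReal_add hW (hnn _), ← ENNReal.ofReal_add hF (hnn _)]
  refine ENNReal.ofReal_le_ofReal ?_
  push_cast at hle
  linarith

end Reroute

/-! ### Conclusion -/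

/-- A compact part of the carrier with density bounded below has finite length. -/
theorem RectData.hausdorffMeasure_ne_top {m : ℕ} (T : RectData m) {I : Set (Euc m)}
    (hIT : I ⊆ T.carrier) (hI : IsCompact I) {a : ℝ} (ha : 0 < a)
    (hθ : ∀ x ∈ I, a ≤ T.density x) : μH[1] I ≠ ⊤ := by
  have hint := T.density_locallyIntegrable.integrableOn_isCompact hI
  rw [IntegrableOn, Measure.restrict_restrict hI.measurableSet,
    inter_eq_self_of_subset_left hIT] at hint
  have hconst : IntegrableOn (fun _ : Euc m => a) I μH[1] := by
    refine hint.mono aestronglyMeasurable_const ?_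
    filter_upwards [ae_restrict_mem hI.measurableSet] with x hx
    have := hθ x hx
    rw [Real.norm_of_nonneg ha.le, Real.norm_of_nonneg (ha.le.trans this)]
    exact this
  rw [integrableOn_const_iff] at hconst
  exact (hconst.resolve_left (by simpa using ha.ne')).ne

theorem mainTheorem3 {m : ℕ} (μm μp : Measure (Euc m)) [IsFiniteMeasure μm] [IsFiniteMeasure μp]
    (hmass : μm univ = μp univ)
    (α c : ℝ) (hα : α ∈ Icc (0 : ℝ) 1) (hc : 0 < c)
    (T : RectData m) (hT : IsTransportPath μm μp T.current)
    (v₁ v₂ : Euc m) (γ : ℝ → Euc m) (hγ : IsRegularCurve T.carrier v₁ v₂ γ)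
    (hdir : RunsAlong γ T.direction)
    (θ₀ : ℤ) (hθ₀ : IsLeast ((fun t => ⌊T.density (γ t) / c⌋) '' Icc (0 : ℝ) 1) θ₀) :
    -- the rerouted current is rectifiable
    (∃ S : RectData m, S.current =
      T.current + ((θ₀ : ℝ) * c) • segmentCurrent v₁ v₂ - ((θ₀ : ℝ) * c) • curveCurrent γ) ∧
    -- its cost, computed from any representation as a rectifiable current
    ∀ S : RectData m, S.current =
        T.current + ((θ₀ : ℝ) * c) • segmentCurrent v₁ v₂ - ((θ₀ : ℝ) * c) • curveCurrent γ →
      S.cost α c ≤ T.cost α c ∧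
      (1 ≤ θ₀ → T.cost α c < ⊤ →
        (S.cost α c = T.cost α c ↔ segment ℝ v₁ v₂ = γ '' Icc (0 : ℝ) 1)) := by
  have hIT : γ '' Icc 0 1 ⊆ T.carrier := hγ.mapsTo.image_subset
  have hIc : IsCompact (γ '' Icc 0 1) := isCompact_Icc.image_of_continuousOn hγ.continuousOn
  have hlow : ∀ x ∈ γ '' Icc (0 : ℝ) 1, (θ₀ : ℝ) * c ≤ T.density x := by
    rintro _ ⟨t, ht, rfl⟩
    have h : θ₀ ≤ ⌊T.density (γ t) / c⌋ := hθ₀.2 ⟨t, ht, rfl⟩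
    exact (le_div_iff₀ hc).1 (Int.le_floor.1 h)
  have hk : 0 ≤ θ₀ := by
    obtain ⟨t, ht, h⟩ := hθ₀.1
    rw [← h]
    exact Int.floor_nonneg.2 (div_nonneg (T.density_pos _ (hγ.mapsTo ht)).le hc.le)
  have hv₁ := hγ.source
  have hv₂ := hγ.target
  -- For θ₀ = 0 the curve may have infinite length, but the zero coefficient removes its current.
  -- For θ₀ > 0 the density bound makes the length finite.
  rcases hk.eq_or_lt with h0 | h0
  · subst h0
    simp only [Int.cast_zero, zero_mul, zero_smul, add_zero, sub_zero]
    exact ⟨⟨T, rfl⟩, fun S hS => ⟨(RectData.cost_eq_of_current_eq hS α c).le,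
      fun h => absurd h (by norm_num)⟩⟩
  have hθpos : (0 : ℝ) < θ₀ := by exact_mod_cast h0
  have hIf := T.hausdorffMeasure_ne_top hIT hIc (mul_pos hθpos hc) hlow
  let R := T.reroute v₁ v₂ ((θ₀ : ℝ) * c) hIT hIc.measurableSet hIf
  have hR : R.current =
      T.current + ((θ₀ : ℝ) * c) • segmentCurrent v₁ v₂ - ((θ₀ : ℝ) * c) • curveCurrent γ :=
    RectData.current_reroute hIT hIc.measurableSet hIf
      (curveDirection_ae_eq hIc.measurableSet hdir)
  refine ⟨⟨R, hR⟩, fun S hS => ?_⟩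
  have hmain := lintegral_capCost_reroute_le (v₁ := v₁) (v₂ := v₂) hα.1 hk hc hIT
    hIc.measurableSet hlow
  have hlen : edist v₁ v₂ ≤ μH[1] (γ '' Icc 0 1) := by
    rw [← hv₁, ← hv₂]
    exact (isPreconnected_Icc.image _ hγ.continuousOn).edist_le_hausdorffMeasure
      (mem_image_of_mem γ (by simp)) (mem_image_of_mem γ (by simp))
  have hcost : S.cost α c = ENNReal.ofReal (c ^ α) * ∫⁻ x, ENNReal.ofReal
      (capCost α c ‖reroutedField T v₁ v₂ (γ '' Icc 0 1) (θ₀ * c) x‖) ∂μH[1] := by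
    rw [RectData.cost_eq_of_current_eq (hS.trans hR.symm), RectData.cost_eq,
      RectData.field_reroute]
  have hcne : ENNReal.ofReal (c ^ α) ≠ 0 := by
    rw [ENNReal.ofReal_ne_zero_iff]; exact Real.rpow_pos_of_pos hc α
  have hθne : ENNReal.ofReal (θ₀ : ℝ) ≠ 0 := by rwa [ENNReal.ofReal_ne_zero_iff]
  constructor
  · rw [hcost, T.cost_eq]
    gcongr 1
    refine (ENNReal.add_le_add_iff_right (ENNReal.mul_ne_top ENNReal.ofReal_ne_top hIf)).1
      (hmain.trans ?_)
    gcongr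
  · refine fun _ hfin => ⟨fun heq => ?_, fun hseg => ?_⟩
    · have hTne : ∫⁻ x, ENNReal.ofReal (capCost α c ‖T.field x‖) ∂μH[1] ≠ ⊤ := by
        intro h
        rw [T.cost_eq, h, ENNReal.mul_top hcne] at hfin
        exact hfin.false
      rw [hcost, T.cost_eq, ENNReal.mul_right_inj hcne ENNReal.ofReal_ne_top] at heq
      -- Finite cost allows the equal integrals to cancel, leaving ℋ¹(I) ≤ |v₁ − v₂|.
      rw [heq, ENNReal.add_le_add_iff_left hTne,
        ENNReal.mul_le_mul_iff_right hθne ENNReal.ofReal_ne_top, ← hv₁, ← hv₂] at hmain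
      rw [← hv₁, ← hv₂]
      exact image_eq_segment_of_hausdorffMeasure_le hγ.continuousOn hγ.differentiable hmain
    · refine RectData.cost_eq_of_current_eq ?_ α c
      rw [← hv₁, ← hv₂] at hseg hS
      rw [hS, curveCurrent_eq_segmentCurrent hγ.continuousOn hγ.differentiable hγ.deriv_ne_zero
        hseg, add_sub_cancel_right]
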